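/- Let $n\ge 1$ and equip $\mathbb{R}^{2n}$, with coordinates $(x_1,y_1,\dots,x_n,y_n)$, with the standard symplectic form $\omega_0=\sum_{i=1}^n dx_i\wedge dy_i$. Let $\gamma_0\colon[0,\infty)\to\mathbb{R}^{2n}$, $\gamma_0(s)=(0,\dots,0,s,0)$. For $\varepsilon>0$ let $B^{2n-2}(\varepsilon)\subset\mathbb{R}^{2n-2}$ be the open ball of radius $\varepsilon$ centered at the origin and let $$W(\varepsilon)=\{(x,y)\in\mathbb{R}^2: x^2+y^2<\varepsilon^2\}\cup\{(x,y)\in\mathbb{R}^2: x>\tfrac{\sqrt2\,\varepsilon}{2},\ x|y|<\tfrac{\varepsilon^2}{2}\}.$$ Let $(M,\omega)$ be a noncompact symplectic manifold of dimension $2n$ (smooth, Hausdorff, second countable, without boundary), and let $\gamma\colon[0,\infty)\to M$ be a proper smooth embedding. The $\gamma$-width of $(M,\omega)$ is the supremum of $\pi\varepsilon^2$ over all $\varepsilon>0$ for which there is a symplectic embedding $j\colon(B^{2n-2}(\varepsilon)\times\mathbb{R}^2,\omega_0)\hookrightarrow(M,\omega)$ with $j\circ\gamma_0=\gamma$ (and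 $0$ if there is no such $\varepsilon$); $(M,\omega)$ is called $\gamma$-wide if its $\gamma$-width is positive. Suppose that $(M,\omega)$ is $\gamma$-wide or, more generally, that for some $\varepsilon>0$ there is a symplectic embedding $j\colon(B^{2n-2}(\varepsilon)\times W(\varepsilon),\omega_0)\hookrightarrow(M,\omega)$ with $j\circ\gamma_0=\gamma$. Then $(M,\omega)$ is symplectomorphic to $(M\setminus\operatorname{image}\gamma,\ \omega|_{M\setminus\operatorname{image}\gamma})$. -/

import Mathlib

open scoped Manifold ContDiff

noncomputable section

namespace RayRemoval

/-! ### Differential 2-forms on manifolds -/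

section Forms

variable {E : Type*} [NormedAddCommGroup E] [NormedSpace ℝ E]
  {H : Type*} [TopologicalSpace H] (I : ModelWithCorners ℝ E H)
  {E' : Type*} [NormedAddCommGroup E'] [NormedSpace ℝ E']
  {H' : Type*} [TopologicalSpace H'] (I' : ModelWithCorners ℝ E' H')
  (M : Type*) [TopologicalSpace M] [ChartedSpace H M]
  {N : Type*} [TopologicalSpace N] [ChartedSpace H' N]

/-- A (not necessarily continuous) differential 2-form: an alternating bilinear form on every
tangent space. -/
abbrev TwoForm : Type _ := (x : M) → (TangentSpace I x) [⋀^Fin 2]→L[ℝ] ℝ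

variable {M}

/-- The pullback `f^* Ω`, that is `(f^* Ω)_x (u, v) = Ω_{f x} (df_x u, df_x v)`. -/
def TwoForm.pullback (f : N → M) (Ω : TwoForm I M) : TwoForm I' N :=
  fun x => (Ω (f x)).compContinuousLinearMap (mfderiv I' I f x)

/-- The restriction of a 2-form to an open subset: the pullback by the inclusion. -/
def TwoForm.restrict (Ω : TwoForm I M) (U : TopologicalSpace.Opens M) : TwoForm I U :=
  TwoForm.pullback I I (Subtype.val : U → M) Ω

/-- The expression of a 2-form in the preferred chart at `x₀`: the pullback by the inverse of the
chart. It is meaningful on the target of the chart. -/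
def TwoForm.inChart (Ω : TwoForm I M) (x₀ : M) : E → E [⋀^Fin 2]→L[ℝ] ℝ :=
  TwoForm.pullback I 𝓘(ℝ, E) (extChartAt I x₀).symm Ω

/-- A symplectic form on a manifold (without boundary): a smooth, closed, nondegenerate 2-form.
Smoothness and closedness are expressed in charts. -/
structure IsSymplecticForm (Ω : TwoForm I M) : Prop where
  smooth : ∀ x₀ : M, ContDiffOn ℝ ∞ (TwoForm.inChart I Ω x₀) (extChartAt I x₀).target
  closed : ∀ x₀ : M, ∀ y ∈ (extChartAt I x₀).target, extDeriv (TwoForm.inChart I Ω x₀) y = 0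
  nondegenerate : ∀ (x : M) (v : TangentSpace I x),
    (∀ w : TangentSpace I x, Ω x ![v, w] = 0) → v = 0

/-- A symplectic embedding `(N, σ) ↪ (M, Ω)`: a smooth embedding `j` with `j^* Ω = σ`. -/
def IsSymplecticEmbedding (σ : TwoForm I' N) (Ω : TwoForm I M) (j : N → M) : Prop :=
  Manifold.IsSmoothEmbedding I' I ∞ j ∧ TwoForm.pullback I I' j Ω = σ

/-- `(N, σ)` and `(M, Ω)` are symplectomorphic: there is a diffeomorphism `φ : N → M` with
`φ^* Ω = σ`. -/
def Symplectomorphic (σ : TwoForm I' N) (Ω : TwoForm I M) : Prop :=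
  ∃ φ : Diffeomorph I' I N M ∞, TwoForm.pullback I I' φ Ω = σ

end Forms

/-! ### The standard symplectic space -/

/-- The space `ℝ^{2n}`, with coordinates ordered as `(x_1, y_1, …, x_n, y_n)`. -/
abbrev Space (n : ℕ) : Type := EuclideanSpace ℝ (Fin (2 * n))

/-- The coordinate `x_{i+1}` (the index `i` starts at `0`). -/
def xCoord {n : ℕ} (i : Fin n) (z : Space n) : ℝ := z ⟨2 * i, by omega⟩

/-- The coordinate `y_{i+1}` (the index `i` starts at `0`). -/
def yCoord {n : ℕ} (i : Fin n) (z : Space n) : ℝ := z ⟨2 * i + 1, by omega⟩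

/-- The standard symplectic form `dx_1 ∧ dy_1 + … + dx_n ∧ dy_n`, as an alternating form. -/
def stdAlt (n : ℕ) : (Space n) [⋀^Fin 2]→L[ℝ] ℝ where
  toFun v := ∑ i : Fin n,
    (xCoord i (v 0) * yCoord i (v 1) - xCoord i (v 1) * yCoord i (v 0))
  map_update_add' v k a b := by
    rw [← Finset.sum_add_distrib]
    refine Finset.sum_congr rfl fun i _ => ?_
    fin_cases k <;> simp [xCoord, yCoord] <;> ring
  map_update_smul' v k c a := by
    rw [smul_eq_mul, Finset.mul_sum]
    refine Finset.sum_congr rfl fun i _ => ?_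
    fin_cases k <;> simp [xCoord, yCoord] <;> ring
  cont := by
    unfold xCoord yCoord
    fun_prop
  map_eq_zero_of_eq' v k l h hkl := by
    have h01 : v 0 = v 1 := by
      fin_cases k <;> fin_cases l <;> simp_all
    simp [h01]

theorem stdAlt_apply (n : ℕ) (v : Fin 2 → Space n) :
    stdAlt n v = ∑ i : Fin n,
      (xCoord i (v 0) * yCoord i (v 1) - xCoord i (v 1) * yCoord i (v 0)) := rfl

/-- The standard symplectic form `ω₀` on the manifold `ℝ^{2n}`. -/
def stdForm (n : ℕ) : TwoForm (𝓡 (2 * n)) (Space n) := fun _ => stdAlt n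

section Models

variable (n : ℕ) [NeZero n]

/-- The index of the last pair of coordinates `(x_n, y_n)`. -/
def lastIdx : Fin n := ⟨n - 1, Nat.sub_lt (Nat.pos_of_ne_zero (NeZero.ne n)) one_pos⟩

/-- The standard ray `γ₀(s) = (0, …, 0, s, 0)`: the coordinate `x_n` is `s`, all others vanish.
The manifold with boundary `[0, ∞)` is `EuclideanHalfSpace 1`. -/
def stdRay (s : EuclideanHalfSpace 1) : Space n :=
  EuclideanSpace.single ⟨2 * (lastIdx n : ℕ), by have := (lastIdx n).isLt; omega⟩ (s.1 0)

/-- `B^{2n-2}(ε) × S` for an open `S ⊆ ℝ²`, as an open subset of `ℝ^{2n}`: the first `n - 1` pairs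
of coordinates form a point of the open ball, and the last pair is a point of `S`. -/
def ballProd (ε : ℝ) (S : TopologicalSpace.Opens (ℝ × ℝ)) : TopologicalSpace.Opens (Space n) where
  carrier := {z | ∑ i ∈ Finset.univ.erase (lastIdx n), (xCoord i z ^ 2 + yCoord i z ^ 2) < ε ^ 2 ∧
    (xCoord (lastIdx n) z, yCoord (lastIdx n) z) ∈ S}
  is_open' := by
    unfold xCoord yCoord
    have h (k : Fin (2 * n)) : Continuous fun z : Space n => z k := by fun_prop
    refine IsOpen.inter ?_ (S.isOpen.preimage ((h _).prodMk (h _)))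
    have hsum : Continuous fun z : Space n => ∑ i ∈ Finset.univ.erase (lastIdx n),
        (z ⟨2 * i, by omega⟩ ^ 2 + z ⟨2 * i + 1, by omega⟩ ^ 2) := by
      fun_prop
    exact isOpen_lt hsum continuous_const

/-- The planar domain
`W(ε) = {x² + y² < ε²} ∪ {x > √2 ε / 2, x |y| < ε² / 2}`. -/
def planarW (ε : ℝ) : TopologicalSpace.Opens (ℝ × ℝ) where
  carrier := {p | p.1 ^ 2 + p.2 ^ 2 < ε ^ 2} ∪
    {p | Real.sqrt 2 * ε / 2 < p.1 ∧ p.1 * |p.2| < ε ^ 2 / 2}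
  is_open' := by
    have h₁ : Continuous fun p : ℝ × ℝ => p.1 ^ 2 + p.2 ^ 2 := by fun_prop
    have h₂ : Continuous fun p : ℝ × ℝ => p.1 * |p.2| := by fun_prop
    exact (isOpen_lt h₁ continuous_const).union
      ((isOpen_lt continuous_const continuous_fst).inter (isOpen_lt h₂ continuous_const))

end Models

/-! ### Proper rays and the width of a ray -/

section Width

variable (n : ℕ) {M : Type*} [TopologicalSpace M] [ChartedSpace (Space n) M]

/-- A proper embedding of the ray `[0, ∞)` into `M`: a smooth embedding (of manifolds with boundary)
that is a proper map. -/
structure IsProperRay (γ : EuclideanHalfSpace 1 → M) : Prop where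
  isSmoothEmbedding : Manifold.IsSmoothEmbedding (𝓡∂ 1) (𝓡 (2 * n)) ∞ γ
  isProperMap : IsProperMap γ

/-- The complement `M \ image γ` of a proper ray, an open subset of `M`. -/
def rayCompl (γ : EuclideanHalfSpace 1 → M) (hγ : IsProperRay n γ) : TopologicalSpace.Opens M where
  carrier := (Set.range γ)ᶜ
  is_open' := hγ.isProperMap.isClosedMap.isClosed_range.isOpen_compl

variable {n} [NeZero n]

/-- There is a symplectic embedding `j : (D, ω₀) ↪ (M, Ω)` with `j ∘ γ₀ = γ`, where `D ⊆ ℝ^{2n}` is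
an open set that contains the standard ray. -/
def ExtendsRay (Ω : TwoForm (𝓡 (2 * n)) M) (γ : EuclideanHalfSpace 1 → M)
    (D : TopologicalSpace.Opens (Space n)) : Prop :=
  ∃ (hD : ∀ s, stdRay n s ∈ D) (j : D → M),
    IsSymplecticEmbedding (𝓡 (2 * n)) (𝓡 (2 * n)) (TwoForm.restrict (𝓡 (2 * n)) (stdForm n) D) Ω j ∧
    ∀ s, j ⟨stdRay n s, hD s⟩ = γ s

/-- The `γ`-width of `(M, Ω)`: the supremum of `π ε²` over all `ε > 0` such that
`(B^{2n-2}(ε) × ℝ², ω₀)` embeds symplectically into `(M, Ω)`, extending `γ`; it is `0` if there is no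
such `ε`. -/
def rayWidth (Ω : TwoForm (𝓡 (2 * n)) M) (γ : EuclideanHalfSpace 1 → M) : ENNReal :=
  ⨆ (ε : ℝ) (_ : 0 < ε ∧ ExtendsRay Ω γ (ballProd n ε ⊤)), ENNReal.ofReal (Real.pi * ε ^ 2)

/-- `(M, Ω)` is `γ`-wide if its `γ`-width is positive. -/
def IsRayWide (Ω : TwoForm (𝓡 (2 * n)) M) (γ : EuclideanHalfSpace 1 → M) : Prop :=
  0 < rayWidth Ω γ

end Width

end RayRemoval

end

/-! The width plays no role: any open neighbourhood of the standard ray that embeds symplectically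
along `γ` suffices. Write `c` for the parametrised image ray. The tip of a ray can be pushed along
it by a symplectomorphism with compact support near the ray. Pushing the tip to infinity in
infinitely many steps removes the ray.

One push comes from the Hamiltonian `χ * y`, where `y` is the last `y`-coordinate and `χ` is a
cutoff equal to `1` on a segment of the line. On the line `y = 0`, so its Hamiltonian vector field
there is `χ` times the direction of the ray. Instead of a flow, the implicit midpoint step `(id + X)
∘ (id - X)⁻¹` is used, with `X` a small multiple of this field: it is exactly symplectic because
second derivatives are symmetric (`apply_add_eq_apply_sub`). Iterating gives a push by at least `1`
(`exists_push`), which extends by the identity to `M` (`exists_diffeomorph_extend`).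

In the infinite composition (`symplectomorphic_of_exists_push`), each new push avoids the image of a
large compact subset of the complement of the ray, and also the compact sets that the remaining ray
has left. Hence the partial compositions stabilise locally off the ray, and their inverses stabilise
locally on all of `M` because the ray is proper. The limits are mutually inverse
(`symplectomorphic_of_rayShifts`). -/

section RayRemovalProofs

open scoped Manifold ContDiff Topology
open Set

noncomputable section

namespace RayRemoval

/-! ### Functoriality and locality of the pullback of 2-forms. -/

section PullbackLemmas

variable {E : Type*} [NormedAddCommGroup E] [NormedSpace ℝ E]
  {H : Type*} [TopologicalSpace H] {I : ModelWithCorners ℝ E H}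
  {E' : Type*} [NormedAddCommGroup E'] [NormedSpace ℝ E']
  {H' : Type*} [TopologicalSpace H'] {I' : ModelWithCorners ℝ E' H'}
  {E'' : Type*} [NormedAddCommGroup E''] [NormedSpace ℝ E'']
  {H'' : Type*} [TopologicalSpace H''] {I'' : ModelWithCorners ℝ E'' H''}
  {M : Type*} [TopologicalSpace M] [ChartedSpace H M]
  {N : Type*} [TopologicalSpace N] [ChartedSpace H' N]
  {P : Type*} [TopologicalSpace P] [ChartedSpace H'' P]

theorem TwoForm.pullback_ext {f g : N → M} {Ω : TwoForm I M} {x : N}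
    (h : ∀ v : Fin 2 → E',
      (Ω (f x) : E [⋀^Fin 2]→L[ℝ] ℝ) (fun i => (mfderiv I' I f x : E' →L[ℝ] E) (v i)) =
      (Ω (g x) : E [⋀^Fin 2]→L[ℝ] ℝ) (fun i => (mfderiv I' I g x : E' →L[ℝ] E) (v i))) :
    TwoForm.pullback I I' f Ω x = TwoForm.pullback I I' g Ω x := by
  have key : (Ω (f x) : E [⋀^Fin 2]→L[ℝ] ℝ).compContinuousLinearMap (mfderiv I' I f x) =
      (Ω (g x) : E [⋀^Fin 2]→L[ℝ] ℝ).compContinuousLinearMap (mfderiv I' I g x : E' →L[ℝ] E) :=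
    ContinuousAlternatingMap.ext h
  exact key

theorem TwoForm.pullback_comp_apply {g : N → M} {f : P → N} (Ω : TwoForm I M) {x : P}
    (hg : MDifferentiableAt I' I g (f x)) (hf : MDifferentiableAt I'' I' f x) :
    TwoForm.pullback I I'' (g ∘ f) Ω x =
      TwoForm.pullback I' I'' f (TwoForm.pullback I I' g Ω) x := by
  unfold TwoForm.pullback
  rw [mfderiv_comp x hg hf]
  rfl

theorem TwoForm.pullback_congr_apply {f g : N → M} (Ω : TwoForm I M) {x : N}
    (h : f =ᶠ[𝓝 x] g) : TwoForm.pullback I I' f Ω x = TwoForm.pullback I I' g Ω x := by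
  have h1 : f x = g x := h.self_of_nhds
  have h2 : (mfderiv I' I f x : E' →L[ℝ] E) = mfderiv I' I g x := h.mfderiv_eq
  have key : ∀ (a b : M) (A B : E' →L[ℝ] E), a = b → A = B →
      (Ω a : E [⋀^Fin 2]→L[ℝ] ℝ).compContinuousLinearMap A =
        (Ω b : E [⋀^Fin 2]→L[ℝ] ℝ).compContinuousLinearMap B := by
    rintro a _ A _ rfl rfl
    rfl
  exact key _ _ _ _ h1 h2

theorem TwoForm.pullback_form_congr_apply {f : N → M} {Ω Ω' : TwoForm I M} {x : N}
    (h : Ω (f x) = Ω' (f x)) : TwoForm.pullback I I' f Ω x = TwoForm.pullback I I' f Ω' x := by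
  unfold TwoForm.pullback
  rw [h]

theorem TwoForm.pullback_id_apply (Ω : TwoForm I M) (x : M) :
    TwoForm.pullback I I id Ω x = Ω x := by
  unfold TwoForm.pullback
  rw [mfderiv_id]
  rfl

theorem TwoForm.pullback_symm (φ : Diffeomorph I' I N M ∞) {σ : TwoForm I' N} {Ω : TwoForm I M}
    (h : TwoForm.pullback I I' φ Ω = σ) : TwoForm.pullback I' I φ.symm σ = Ω := by
  funext y
  have h0 : (∞ : WithTop ℕ∞) ≠ 0 := by simp
  rw [← h, ← TwoForm.pullback_comp_apply (I := I) (I' := I') (I'' := I) Ω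
    (φ.mdifferentiable h0 _) (φ.symm.mdifferentiable h0 _)]
  have : (φ : N → M) ∘ φ.symm = id := by ext; simp
  rw [this, TwoForm.pullback_id_apply]

theorem TwoForm.pullback_trans (φ : Diffeomorph I'' I' P N ∞) (ψ : Diffeomorph I' I N M ∞)
    {ρ : TwoForm I'' P} {σ : TwoForm I' N} {Ω : TwoForm I M}
    (hφ : TwoForm.pullback I' I'' φ σ = ρ) (hψ : TwoForm.pullback I I' ψ Ω = σ) :
    TwoForm.pullback I I'' (φ.trans ψ) Ω = ρ := by
  funext y
  have h0 : (∞ : WithTop ℕ∞) ≠ 0 := by simp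
  rw [← hφ, ← hψ, ← TwoForm.pullback_comp_apply (I := I) (I' := I') (I'' := I'') Ω
    (ψ.mdifferentiable h0 _) (φ.mdifferentiable h0 _)]
  rfl

end PullbackLemmas

/-! ### Removing a ray by an infinite composition -/

section Limit

/-- A single limit function serves all base points, since the eventual value at `z` does not depend
on the stage from which stability is known. Where the sequence never stabilises the value is
arbitrary. -/
theorem exists_eventual_value {X Y : Type*} [TopologicalSpace X] (f : ℕ → X → Y) :
    ∃ F : X → Y, ∀ x k₀, (∀ᶠ z in 𝓝 x, ∀ k ≥ k₀, f k z = f k₀ z) →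
      ∀ᶠ z in 𝓝 x, ∀ k ≥ k₀, F z = f k z := by
  classical
  refine ⟨fun z => if h : ∃ k₀, ∀ k ≥ k₀, f k z = f k₀ z then f h.choose z else f 0 z,
    fun x k₀ h => h.mono fun z hz k hk => ?_⟩
  have hex : ∃ k₀, ∀ k ≥ k₀, f k z = f k₀ z := ⟨k₀, hz⟩
  simp only [hex, ↓reduceDIte]
  rw [← hex.choose_spec (max hex.choose k) (le_max_left _ _),
    hz (max hex.choose k) (hk.trans (le_max_right _ _)), hz k hk]

variable {E : Type*} [NormedAddCommGroup E] [NormedSpace ℝ E]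
  {H : Type*} [TopologicalSpace H] {I : ModelWithCorners ℝ E H}
  {M : Type*} [TopologicalSpace M] [ChartedSpace H M]

/-- A symplectomorphism of `M` that maps the ray `c ([0, ∞))` onto `c ([t, ∞))`. -/
structure RayShift (Ω : TwoForm I M) (c : ℝ → M) where
  toDiffeo : Diffeomorph I I M M ∞
  tip : ℝ
  tip_nonneg : 0 ≤ tip
  pullback_eq : TwoForm.pullback I I toDiffeo Ω = Ω
  image_eq : toDiffeo '' (c '' Ici 0) = c '' Ici tip

theorem symplectomorphic_of_rayShifts {Ω : TwoForm I M} {c : ℝ → M} (U : TopologicalSpace.Opens M)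
    (hU : (U : Set M) = (c '' Ici 0)ᶜ) (S : ℕ → RayShift Ω c)
    (hfwd : ∀ p ∈ U, ∃ k₀, ∀ᶠ z in 𝓝 p, ∀ k ≥ k₀, (S k).toDiffeo z = (S k₀).toDiffeo z)
    (hbwd : ∀ q, ∃ k₀, ∀ᶠ z in 𝓝 q, ∀ k ≥ k₀,
      (S k).toDiffeo.symm z = (S k₀).toDiffeo.symm z)
    (htip : ∀ q, ∃ k₀, ∀ k ≥ k₀, q ∉ c '' Ici (S k).tip) :
    Symplectomorphic I I Ω (TwoForm.restrict I Ω U) := by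
  have h0 : (∞ : WithTop ℕ∞) ≠ 0 := by simp
  obtain ⟨F, hF⟩ := exists_eventual_value (fun k => ((S k).toDiffeo : M → M))
  obtain ⟨G, hG⟩ := exists_eventual_value (fun k => ((S k).toDiffeo.symm : M → M))
  have hF' : ∀ p ∈ U, ∃ k₀, ∀ᶠ z in 𝓝 p, ∀ k ≥ k₀, F z = (S k).toDiffeo z := fun p hp =>
    (hfwd p hp).imp fun k₀ h => hF p k₀ h
  have hG' : ∀ q, ∃ k₀, ∀ᶠ z in 𝓝 q, ∀ k ≥ k₀, G z = (S k).toDiffeo.symm z := fun q =>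
    (hbwd q).imp fun k₀ h => hG q k₀ h
  have hmem : ∀ q, G q ∈ U := by
    intro q
    obtain ⟨k₀, h₀⟩ := hG' q
    obtain ⟨k₁, h₁⟩ := htip q
    have e := h₀.self_of_nhds (max k₀ k₁) (le_max_left _ _)
    rw [← SetLike.mem_coe, hU]
    -- If `G q` were on the ray, then `q = S k (G q)` would lie on `c '' Ici (S k).tip` for a large
    -- `k`.
    intro hq
    apply h₁ (max k₀ k₁) (le_max_right _ _)
    rw [← (S _).image_eq]
    exact ⟨_, hq, by rw [e]; simp⟩
  have hGF : ∀ p ∈ U, G (F p) = p := by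
    intro p hp
    obtain ⟨k₀, h₀⟩ := hF' p hp
    obtain ⟨k₁, h₁⟩ := hG' (F p)
    rw [h₁.self_of_nhds (max k₀ k₁) (le_max_right _ _),
      h₀.self_of_nhds (max k₀ k₁) (le_max_left _ _)]
    simp
  have hFG : ∀ q, F (G q) = q := by
    intro q
    obtain ⟨k₀, h₀⟩ := hF' (G q) (hmem q)
    obtain ⟨k₁, h₁⟩ := hG' q
    rw [h₀.self_of_nhds (max k₀ k₁) (le_max_left _ _),
      h₁.self_of_nhds (max k₀ k₁) (le_max_right _ _)]
    simp
  have hGloc : ∀ q, ∃ k, G =ᶠ[𝓝 q] (S k).toDiffeo.symm := fun q => by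
    obtain ⟨k₀, h₀⟩ := hG' q
    exact ⟨k₀, h₀.mono fun z hz => hz k₀ le_rfl⟩
  have hGs : ContMDiff I I ∞ G := fun q => by
    obtain ⟨k, hk⟩ := hGloc q
    exact ((S k).toDiffeo.symm.contMDiff q).congr_of_eventuallyEq hk
  have hFs : ∀ p ∈ U, ContMDiffAt I I ∞ F p := fun p hp => by
    obtain ⟨k₀, h₀⟩ := hF' p hp
    exact ((S k₀).toDiffeo.contMDiff p).congr_of_eventuallyEq (h₀.mono fun z hz => hz k₀ le_rfl)
  let Φ : Diffeomorph I I M U ∞ :=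
    { toFun := fun q => ⟨G q, hmem q⟩
      invFun := fun p => F p
      left_inv := hFG
      right_inv := fun p => Subtype.ext (hGF p p.2)
      contMDiff_toFun := by
        rw [← ContMDiff.subtypeVal_comp_iff]
        exact hGs
      contMDiff_invFun := fun p => (hFs p p.2).comp p (contMDiff_subtype_val p) }
  refine ⟨Φ, ?_⟩
  funext q
  unfold TwoForm.restrict
  rw [← TwoForm.pullback_comp_apply (I := I) (I' := I) (I'' := I) Ω
    ((contMDiff_subtype_val (n := ∞) _).mdifferentiableAt h0) (Φ.mdifferentiable h0 _)]
  obtain ⟨k, hk⟩ := hGloc q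
  have : (Subtype.val : U → M) ∘ Φ =ᶠ[𝓝 q] (S k).toDiffeo.symm := hk
  rw [TwoForm.pullback_congr_apply Ω this, TwoForm.pullback_symm _ (S k).pullback_eq]

end Limit

/-! ### Inductive choice of the pushes along compact exhaustions. -/

section Exhaustion

variable {E : Type*} [NormedAddCommGroup E] [NormedSpace ℝ E]
  {H : Type*} [TopologicalSpace H] {I : ModelWithCorners ℝ E H}
  {M : Type*} [TopologicalSpace M] [ChartedSpace H M]

theorem exists_compact_exhaustion_of_isOpen {X : Type*} [TopologicalSpace X] [LocallyCompactSpace X]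
    [SecondCountableTopology X] (U : TopologicalSpace.Opens X) :
    ∃ C : ℕ → Set X, (∀ k, IsCompact (C k)) ∧ (∀ k, C k ⊆ U) ∧ Monotone C ∧
      ∀ x ∈ U, ∃ k, C k ∈ 𝓝 x := by
  have : LocallyCompactSpace U := U.isOpen.locallyCompactSpace
  let K : CompactExhaustion U := default
  refine ⟨fun k => Subtype.val '' K k, fun k => (K.isCompact k).image continuous_subtype_val,
    fun k => ?_, fun a b h => image_mono (K.subset h), fun x hx => ?_⟩
  · rintro _ ⟨y, -, rfl⟩
    exact y.2
  · obtain ⟨k, hk⟩ := K.exists_mem_nhds ⟨x, hx⟩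
    exact ⟨k, U.isOpen.isOpenEmbedding_subtypeVal.image_mem_nhds.2 hk⟩

/-- If a proper ray can be pushed into itself by a definite amount, by symplectomorphisms supported
in any given neighbourhood of it, then it can be removed. -/
theorem symplectomorphic_of_exists_push [T2Space M] [LocallyCompactSpace M]
    [SecondCountableTopology M] {Ω : TwoForm I M} {c : ℝ → M} (U : TopologicalSpace.Opens M)
    (hU : (U : Set M) = (c '' Ici 0)ᶜ)
    (hproper : ∀ K : Set M, IsCompact K → ∃ T, ∀ s ≥ T, c s ∉ K)
    (hpush : ∀ t ≥ 0, ∀ N : Set M, IsOpen N → c '' Ici t ⊆ N →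
      ∃ t' ≥ t + 1, ∃ φ : Diffeomorph I I M M ∞, TwoForm.pullback I I φ Ω = Ω ∧
        (∀ p ∉ N, φ p = p) ∧ φ '' (c '' Ici t) = c '' Ici t') :
    Symplectomorphic I I Ω (TwoForm.restrict I Ω U) := by
  obtain ⟨C, hCc, hCU, hCm, hC⟩ := exists_compact_exhaustion_of_isOpen U
  let K : CompactExhaustion M := default
  have hnext : ∀ (k : ℕ) (s : RayShift Ω c), ∃ s' : RayShift Ω c, s.tip + 1 ≤ s'.tip ∧
      (∀ x ∈ C k, s'.toDiffeo x = s.toDiffeo x) ∧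
      ∀ m ≤ k, Disjoint (K m) (c '' Ici s.tip) →
        ∀ y ∈ K m, s'.toDiffeo.symm y = s.toDiffeo.symm y := by
    intro k s
    -- `Q` collects the sets of the exhaustion that the remaining ray has already left; the bound `m
    -- ≤ k` makes the union finite, hence closed. A push supported off `Q` does not change the
    -- inverse there, and one supported off the image of `C k` does not change the map on `C k`.
    let Q : Set M := ⋃ m ∈ {m | m ≤ k ∧ Disjoint (K m) (c '' Ici s.tip)}, K m
    have hQ : IsClosed Q := Set.Finite.isClosed_biUnion ((finite_le_nat k).subset fun m hm => hm.1)
      fun m _ => (K.isCompact m).isClosed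
    have hP : IsClosed (s.toDiffeo '' C k) := ((hCc k).image s.toDiffeo.continuous).isClosed
    obtain ⟨t', ht', φ, hφ, hsupp, himg⟩ := hpush s.tip s.tip_nonneg (s.toDiffeo '' C k ∪ Q)ᶜ
      (hP.union hQ).isOpen_compl (by
        intro y hy hy'
        rcases hy' with hy' | hy'
        · rw [← s.image_eq] at hy
          obtain ⟨x, hx, rfl⟩ := hy
          obtain ⟨x', hx', he⟩ := hy'
          rw [s.toDiffeo.injective he] at hx'
          have := hCU k hx'
          rw [hU] at this
          exact this hx
        · simp only [Q, mem_iUnion] at hy'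
          obtain ⟨m, hm, hy'⟩ := hy'
          exact disjoint_left.1 hm.2 hy' hy)
    have hfix : ∀ x, s.toDiffeo x ∈ s.toDiffeo '' C k ∪ Q →
        (s.toDiffeo.trans φ) x = s.toDiffeo x := fun x hx => hsupp _ (fun h => h hx)
    refine ⟨⟨s.toDiffeo.trans φ, t', by linarith [s.tip_nonneg],
      TwoForm.pullback_trans _ _ s.pullback_eq hφ, ?_⟩, ht', fun x hx => ?_, fun m hm hd y hy => ?_⟩
    · rw [Diffeomorph.coe_trans, image_comp, s.image_eq, himg]
    · exact hfix x (Or.inl (mem_image_of_mem _ hx))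
    · have h1 : y ∈ Q := mem_biUnion (show m ∈ {m | _} from ⟨hm, hd⟩) hy
      have h2 := hfix (s.toDiffeo.symm y) (Or.inr (by simpa using h1))
      rw [s.toDiffeo.apply_symm_apply] at h2
      change (s.toDiffeo.trans φ).symm y = _
      rw [← h2, (s.toDiffeo.trans φ).symm_apply_apply, h2]
  choose next hnext1 hnext2 hnext3 using hnext
  let s₀ : RayShift Ω c := ⟨Diffeomorph.refl I M ∞, 0, le_rfl, by
    funext x; exact TwoForm.pullback_id_apply Ω x, by simp⟩
  let S : ℕ → RayShift Ω c := fun k => Nat.rec s₀ next k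
  have hS : ∀ k, S (k + 1) = next k (S k) := fun k => rfl
  have htip : ∀ k : ℕ, (k : ℝ) ≤ (S k).tip := by
    intro k
    induction k with
    | zero => simpa using (S 0).tip_nonneg
    | succ k ih =>
      have := hnext1 k (S k)
      rw [hS]
      push_cast
      linarith
  -- The tips tend to infinity, so by properness the remaining ray leaves a compact neighbourhood of
  -- `q`. Requiring `m ≤ k₀` ensures that this neighbourhood is among the sets protected from stage
  -- `k₀` on.
  have hevade : ∀ q, ∃ m k₀, m ≤ k₀ ∧ K m ∈ 𝓝 q ∧
      ∀ k ≥ k₀, Disjoint (K m) (c '' Ici (S k).tip) := by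
    intro q
    obtain ⟨m, hm⟩ := K.exists_mem_nhds q
    obtain ⟨T, hT⟩ := hproper (K m) (K.isCompact m)
    obtain ⟨k₁, hk₁⟩ := exists_nat_ge T
    refine ⟨m, max m k₁, le_max_left _ _, hm, fun k hk => ?_⟩
    rw [disjoint_right]
    rintro _ ⟨s, hs, rfl⟩
    refine hT s ?_
    have h1 : (k₁ : ℝ) ≤ k := by exact_mod_cast (le_max_right _ _).trans hk
    have h2 := htip k
    have h3 : (S k).tip ≤ s := hs
    linarith
  refine symplectomorphic_of_rayShifts U hU S (fun p hp => ?_) (fun q => ?_) fun q => ?_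
  · obtain ⟨k₀, hk₀⟩ := hC p hp
    refine ⟨k₀, Filter.mem_of_superset hk₀ fun z hz k hk => ?_⟩
    induction k, hk using Nat.le_induction with
    | base => rfl
    | succ k hk ih => rw [hS, hnext2 k (S k) z (hCm hk hz), ih]
  · obtain ⟨m, k₀, hmk, hm, hd⟩ := hevade q
    refine ⟨k₀, Filter.mem_of_superset hm fun z hz k hk => ?_⟩
    induction k, hk using Nat.le_induction with
    | base => rfl
    | succ k hk ih => rw [hS, hnext3 k (S k) m (hmk.trans hk) (hd k hk) z hz, ih]
  · obtain ⟨m, k₀, -, hm, hd⟩ := hevade q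
    exact ⟨k₀, fun k hk => disjoint_left.1 (hd k hk) (mem_of_mem_nhds hm)⟩

end Exhaustion

/-! ### Extension of compactly supported symplectomorphisms by the identity. -/

section Transport

/-- Extension by the identity of a self-map of the source of a chart. -/
def conjExtend {X Y : Type*} [TopologicalSpace X] [TopologicalSpace Y]
    (e : OpenPartialHomeomorph X Y) (f : X → X) : Y → Y :=
  open scoped Classical in fun y => if y ∈ e.target then e (f (e.symm y)) else y

section

variable {X Y : Type*} [TopologicalSpace X] [TopologicalSpace Y]
  {e : OpenPartialHomeomorph X Y} {f g : X → X} {K : Set X}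

theorem conjExtend_apply {x : X} (hx : x ∈ e.source) : conjExtend e f (e x) = e (f x) := by
  simp [conjExtend, e.map_source hx, e.left_inv hx]

theorem conjExtend_of_notMem {y : Y} (hf : ∀ x ∉ K, f x = x)
    (hy : y ∉ e '' K) : conjExtend e f y = y := by
  unfold conjExtend
  split_ifs with h
  · rw [hf, e.right_inv h]
    exact fun hk => hy ⟨_, hk, e.right_inv h⟩
  · rfl

/-- A point `f x` outside `A` is fixed by `f`, so injectivity gives `f x = x`, which lies in `A`. -/
theorem mapsTo_of_fixed {X : Type*} {f : X → X} {A K : Set X} (hK : K ⊆ A) (hf : ∀ x ∉ K, f x = x)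
    (hi : Function.Injective f) : MapsTo f A A := by
  intro x hx
  by_contra h
  have h1 := hi (hf (f x) fun h' => h (hK h'))
  exact h (by rwa [h1])

theorem conjExtend_leftInverse (hf : MapsTo f e.source e.source)
    (h : Function.LeftInverse g f) : Function.LeftInverse (conjExtend e g) (conjExtend e f) := by
  intro y
  by_cases hy : y ∈ e.target
  · have h1 := e.map_target hy
    conv_lhs => rw [← e.right_inv hy]
    rw [conjExtend_apply h1, conjExtend_apply (hf h1), h, e.right_inv hy]
  · simp [conjExtend, hy]

end

/-- As `M` is Hausdorff, the compact set `e '' K` is closed, so the extension is the identity near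
every point off it. Near its points the extension is the conjugate by `e`, and `e` is symplectic. -/
theorem exists_diffeomorph_extend {n : ℕ} {M : Type*} [TopologicalSpace M]
    [ChartedSpace (Space n) M] [T2Space M] {Ω : TwoForm (𝓡 (2 * n)) M}
    (e : OpenPartialHomeomorph (Space n) M)
    (he : ContMDiffOn (𝓡 (2 * n)) (𝓡 (2 * n)) ∞ e e.source)
    (he' : ContMDiffOn (𝓡 (2 * n)) (𝓡 (2 * n)) ∞ e.symm e.target)
    (hΩ : ∀ x ∈ e.source, TwoForm.pullback (𝓡 (2 * n)) (𝓡 (2 * n)) e Ω x = stdForm n x)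
    (ψ : Diffeomorph (𝓡 (2 * n)) (𝓡 (2 * n)) (Space n) (Space n) ∞)
    (hψ : TwoForm.pullback (𝓡 (2 * n)) (𝓡 (2 * n)) ψ (stdForm n) = stdForm n)
    {K : Set (Space n)} (hK : IsCompact K) (hKe : K ⊆ e.source) (hfix : ∀ x ∉ K, ψ x = x) :
    ∃ φ : Diffeomorph (𝓡 (2 * n)) (𝓡 (2 * n)) M M ∞,
      TwoForm.pullback (𝓡 (2 * n)) (𝓡 (2 * n)) φ Ω = Ω ∧
      (∀ p ∉ e '' K, φ p = p) ∧ ∀ x ∈ e.source, φ (e x) = e (ψ x) := by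
  have h0 : (∞ : WithTop ℕ∞) ≠ 0 := by simp
  have hfix' : ∀ x ∉ K, ψ.symm x = x := fun x hx => by
    conv_lhs => rw [← hfix x hx]
    simp
  have hm : MapsTo ψ e.source e.source := mapsTo_of_fixed hKe hfix ψ.injective
  have hm' : MapsTo ψ.symm e.source e.source := mapsTo_of_fixed hKe hfix' ψ.symm.injective
  have hcl : IsClosed (e '' K) := (hK.image_of_continuousOn (e.continuousOn.mono hKe)).isClosed
  have hoff : ∀ (f : Space n → Space n), (∀ x ∉ K, f x = x) → ∀ p ∉ e '' K,
      conjExtend e f =ᶠ[𝓝 p] id := fun f hf p hp =>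
    Filter.mem_of_superset (hcl.isOpen_compl.mem_nhds hp) fun q hq =>
      conjExtend_of_notMem hf hq
  have hon : ∀ (f : Space n → Space n), ∀ p ∈ e '' K,
      p ∈ e.target ∧ conjExtend e f =ᶠ[𝓝 p] e ∘ f ∘ e.symm := by
    rintro f _ ⟨x, hx, rfl⟩
    have h1 := e.map_source (hKe hx)
    refine ⟨h1, Filter.mem_of_superset (e.open_target.mem_nhds h1) fun q (hq : q ∈ e.target) => ?_⟩
    change conjExtend e f q = e (f (e.symm q))
    simp [conjExtend, hq]
  have hsmooth : ∀ (f : Space n → Space n), ContMDiff (𝓡 (2 * n)) (𝓡 (2 * n)) ∞ f →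
      (∀ x ∉ K, f x = x) → MapsTo f e.source e.source →
      ContMDiff (𝓡 (2 * n)) (𝓡 (2 * n)) ∞ (conjExtend e f) := by
    intro f hf hfK hfm p
    by_cases hp : p ∈ e '' K
    · obtain ⟨hpt, hev⟩ := hon f p hp
      refine ContMDiffAt.congr_of_eventuallyEq ?_ hev
      have h1 := e.map_target hpt
      exact ((he.contMDiffAt (e.open_source.mem_nhds (hfm h1))).comp _ (hf _)).comp p
        (he'.contMDiffAt (e.open_target.mem_nhds hpt))
    · exact contMDiffAt_id.congr_of_eventuallyEq (hoff f hfK p hp)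
  let φ : Diffeomorph (𝓡 (2 * n)) (𝓡 (2 * n)) M M ∞ :=
    { toFun := conjExtend e ψ
      invFun := conjExtend e ψ.symm
      left_inv := conjExtend_leftInverse hm ψ.symm_apply_apply
      right_inv := conjExtend_leftInverse hm' ψ.apply_symm_apply
      contMDiff_toFun := hsmooth _ ψ.contMDiff hfix hm
      contMDiff_invFun := hsmooth _ ψ.symm.contMDiff hfix' hm' }
  refine ⟨φ, ?_, fun p hp => conjExtend_of_notMem hfix hp, fun x hx => conjExtend_apply hx⟩
  funext p
  by_cases hp : p ∈ e '' K
  · obtain ⟨hpt, hev⟩ := hon ψ p hp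
    have h1 := e.map_target hpt
    have d1 : MDifferentiableAt (𝓡 (2 * n)) (𝓡 (2 * n)) e.symm p :=
      (he'.contMDiffAt (e.open_target.mem_nhds hpt)).mdifferentiableAt h0
    have d2 : MDifferentiableAt (𝓡 (2 * n)) (𝓡 (2 * n)) ψ (e.symm p) := ψ.mdifferentiable h0 _
    have d3 : ∀ x ∈ e.source, MDifferentiableAt (𝓡 (2 * n)) (𝓡 (2 * n)) e x := fun x hx =>
      (he.contMDiffAt (e.open_source.mem_nhds hx)).mdifferentiableAt h0
    have e1 : e ∘ e.symm =ᶠ[𝓝 p] id :=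
      Filter.mem_of_superset (e.open_target.mem_nhds hpt) fun q hq => e.right_inv hq
    have key : TwoForm.pullback (𝓡 (2 * n)) (𝓡 (2 * n)) (e ∘ ψ) Ω (e.symm p) =
        TwoForm.pullback (𝓡 (2 * n)) (𝓡 (2 * n)) e Ω (e.symm p) := by
      rw [TwoForm.pullback_comp_apply (I' := 𝓡 (2 * n)) Ω (d3 _ (hm h1)) d2,
        TwoForm.pullback_form_congr_apply (hΩ _ (hm h1)), hψ, hΩ _ h1]
    rw [TwoForm.pullback_congr_apply (f := φ) Ω hev, ← Function.comp_assoc,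
      TwoForm.pullback_comp_apply (I' := 𝓡 (2 * n)) Ω ((d3 _ (hm h1)).comp _ d2) d1,
      TwoForm.pullback_form_congr_apply key,
      ← TwoForm.pullback_comp_apply (I' := 𝓡 (2 * n)) Ω (d3 _ h1) d1,
      TwoForm.pullback_congr_apply Ω e1, TwoForm.pullback_id_apply]
  · rw [TwoForm.pullback_congr_apply (f := φ) Ω (hoff ψ hfix p hp), TwoForm.pullback_id_apply]

end Transport

/-! ### Equidimensional symplectic embeddings as symplectic charts. -/

section Embedding

/-- A smooth immersion between boundaryless manifolds of the same finite dimension is open. -/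
theorem isOpenMap_of_isImmersion {E : Type*} [NormedAddCommGroup E] [NormedSpace ℝ E]
    [FiniteDimensional ℝ E] {N M : Type*} [TopologicalSpace N] [ChartedSpace E N]
    [TopologicalSpace M] [ChartedSpace E M] {f : N → M}
    (hf : Manifold.IsImmersion 𝓘(ℝ, E) 𝓘(ℝ, E) ∞ f) : IsOpenMap f := by
  rw [isOpenMap_iff_nhds_le]
  intro x
  have hx := hf.isImmersionAt x
  -- Equal dimensions leave no room for a complement, so in suitable charts `f` is a linear
  -- isomorphism.
  have hsub : Subsingleton hx.complement := by
    have hfd : FiniteDimensional ℝ (E × hx.complement) :=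
      hx.equiv.symm.toLinearEquiv.finiteDimensional
    have : FiniteDimensional ℝ hx.complement :=
      FiniteDimensional.of_surjective (LinearMap.snd ℝ E hx.complement) Prod.snd_surjective
    have h := hx.equiv.toLinearEquiv.finrank_eq
    rw [Module.finrank_prod] at h
    exact (Module.finrank_zero_iff (R := ℝ)).1 (by omega)
  let _ : Unique hx.complement := ⟨⟨0⟩, fun _ => Subsingleton.elim _ _⟩
  let L : E ≃ₜ E := ((ContinuousLinearEquiv.prodUnique ℝ E hx.complement).symm.trans
    hx.equiv).toHomeomorph
  let d := hx.domChart
  let c := hx.codChart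
  have hev : f =ᶠ[𝓝 x] c.symm ∘ L ∘ d := by
    refine Filter.mem_of_superset (d.open_source.mem_nhds hx.mem_domChart_source) fun z hz => ?_
    have h1 := hx.writtenInCharts (show d z ∈ (hx.domChart.extend 𝓘(ℝ, E)).target by
      simpa using d.map_source hz)
    have h2 : hx.domChart.symm (d z) = z := d.left_inv hz
    simp only [OpenPartialHomeomorph.extend_coe, OpenPartialHomeomorph.extend_coe_symm,
      modelWithCornersSelf_coe, modelWithCornersSelf_coe_symm, Function.comp_apply, id, h2] at h1
    have h3 : L (d z) = c (f z) := by
      rw [h1]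
      change hx.equiv _ = _
      congr 1
    change f z = c.symm (L (d z))
    rw [h3]
    exact (c.left_inv (hx.source_subset_preimage_source hz)).symm
  have hLx : L (d x) = c (f x) := by
    have h1 := hev.self_of_nhds
    have h2 := hx.writtenInCharts (show d x ∈ (hx.domChart.extend 𝓘(ℝ, E)).target by
      simpa using d.map_source hx.mem_domChart_source)
    have h3 : hx.domChart.symm (d x) = x := d.left_inv hx.mem_domChart_source
    simp only [OpenPartialHomeomorph.extend_coe, OpenPartialHomeomorph.extend_coe_symm,
      modelWithCornersSelf_coe, modelWithCornersSelf_coe_symm, Function.comp_apply, id, h3] at h2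
    rw [h2]
    change hx.equiv _ = _
    congr 1
  rw [Filter.map_congr hev, ← Filter.map_map, ← Filter.map_map,
    d.map_nhds_eq hx.mem_domChart_source, L.map_nhds_eq, hLx,
    c.symm.map_nhds_eq (c.map_source hx.mem_codChart_source),
    c.left_inv hx.mem_codChart_source]

/-- A symplectic embedding of an open subset of `ℝ^{2n}` into a manifold of the same dimension is
given by an open partial homeomorphism. -/
theorem exists_openPartialHomeomorph {n : ℕ} {M : Type*} [TopologicalSpace M]
    [ChartedSpace (Space n) M] {Ω : TwoForm (𝓡 (2 * n)) M}
    (D : TopologicalSpace.Opens (Space n)) [Nonempty D] {j : D → M}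
    (hj : IsSymplecticEmbedding (𝓡 (2 * n)) (𝓡 (2 * n))
      (TwoForm.restrict (𝓡 (2 * n)) (stdForm n) D) Ω j) :
    ∃ e : OpenPartialHomeomorph (Space n) M, e.source = D ∧ (∀ x : D, e x = j x) ∧
      ContMDiffOn (𝓡 (2 * n)) (𝓡 (2 * n)) ∞ e e.source ∧
      ContMDiffOn (𝓡 (2 * n)) (𝓡 (2 * n)) ∞ e.symm e.target ∧
      ∀ x ∈ e.source, TwoForm.pullback (𝓡 (2 * n)) (𝓡 (2 * n)) e Ω x = stdForm n x := by
  have h0 : (∞ : WithTop ℕ∞) ≠ 0 := by simp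
  have himm := hj.1.isImmersion
  have hopen : IsOpenMap j := isOpenMap_of_isImmersion himm
  have hoe : Topology.IsOpenEmbedding j := .of_isEmbedding_isOpenMap hj.1.isEmbedding hopen
  let a : OpenPartialHomeomorph D (Space n) := D.openPartialHomeomorphSubtypeCoe inferInstance
  let b : OpenPartialHomeomorph D M := hoe.toOpenPartialHomeomorph j
  let e := a.symm.trans b
  have hsource : e.source = D := by ext; simp [e, a, b]
  have hval : ∀ x : D, e x = j x := fun x => by
    change j (a.symm x) = j x
    rw [show (x : Space n) = a x from rfl, a.left_inv (by simp [a])]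
  have htarget : e.target = range j := by ext; simp [e, a, b]
  have hsymm : ∀ x : D, e.symm (j x) = x := fun x => by
    rw [← hval, e.left_inv (by rw [hsource]; exact x.2)]
  have hejv : e ∘ (Subtype.val : D → Space n) = j := funext hval
  have hsm : ContMDiffOn (𝓡 (2 * n)) (𝓡 (2 * n)) ∞ e e.source := by
    intro x hx
    rw [hsource] at hx
    refine ContMDiffAt.contMDiffWithinAt ?_
    exact (contMDiffAt_subtype_iff (x := (⟨x, hx⟩ : D))).1
      ((himm.contMDiff _).congr_of_eventuallyEq (Filter.Eventually.of_forall hval))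
  refine ⟨e, hsource, hval, hsm, ?_, ?_⟩
  · intro y hy
    rw [htarget] at hy
    obtain ⟨x, rfl⟩ := hy
    refine ContMDiffAt.contMDiffWithinAt ?_
    have hb : ContMDiffAt (𝓡 (2 * n)) (𝓡 (2 * n)) ∞ b.symm (j x) := by
      -- A continuous map is smooth once its composition with an immersion is; here the composition
      -- is the identity near `j x`.
      rw [ContMDiffAt.iff_comp_isImmersionAt (himm.isImmersionAt _)]
      have hmem : j x ∈ b.target := by simp [b]
      refine ⟨b.symm.continuousAt hmem, contMDiffAt_id.congr_of_eventuallyEq ?_⟩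
      exact Filter.mem_of_superset (b.open_target.mem_nhds hmem) fun z hz => b.right_inv hz
    exact (contMDiff_subtype_val _).comp (j x) hb
  · intro x hx
    have hxD : x ∈ D := by rw [← SetLike.mem_coe, ← hsource]; exact hx
    have hv : ∀ z : D, MDifferentiableAt (𝓡 (2 * n)) (𝓡 (2 * n)) (Subtype.val : D → Space n) z :=
      fun z => ((contMDiff_subtype_val (n := ∞) _).mdifferentiableAt h0)
    have hav : a.symm x = ⟨x, hxD⟩ := a.left_inv (x := ⟨x, hxD⟩) (by simp [a])
    have hev : (Subtype.val : D → Space n) ∘ a.symm =ᶠ[𝓝 x] id :=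
      Filter.mem_of_superset (D.isOpen.mem_nhds hxD) fun z hz =>
        a.right_inv (by simpa [a] using hz)
    have ha : MDifferentiableAt (𝓡 (2 * n)) (𝓡 (2 * n)) a.symm x :=
      ((ContMDiffAt.subtypeVal_comp_iff D a.symm x).1
        (contMDiffAt_id.congr_of_eventuallyEq hev)).mdifferentiableAt h0
    have hcancel : ∀ Θ : TwoForm (𝓡 (2 * n)) (Space n),
        TwoForm.pullback (𝓡 (2 * n)) (𝓡 (2 * n)) a.symm
          (TwoForm.pullback (𝓡 (2 * n)) (𝓡 (2 * n)) (Subtype.val : D → Space n) Θ) x = Θ x := by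
      intro Θ
      rw [← TwoForm.pullback_comp_apply (I' := 𝓡 (2 * n)) Θ (hv _) ha,
        TwoForm.pullback_congr_apply Θ hev, TwoForm.pullback_id_apply]
    have key : TwoForm.pullback (𝓡 (2 * n)) (𝓡 (2 * n)) (Subtype.val : D → Space n)
        (TwoForm.pullback (𝓡 (2 * n)) (𝓡 (2 * n)) e Ω) =
        TwoForm.pullback (𝓡 (2 * n)) (𝓡 (2 * n)) (Subtype.val : D → Space n) (stdForm n) := by
      refine Eq.trans ?_ hj.2
      funext z
      have hz : (z : Space n) ∈ e.source := by rw [hsource]; exact z.2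
      rw [← TwoForm.pullback_comp_apply (I' := 𝓡 (2 * n)) Ω
        ((hsm.contMDiffAt (e.open_source.mem_nhds hz)).mdifferentiableAt h0) (hv _), hejv]
    rw [← hcancel (TwoForm.pullback _ _ e Ω), key, hcancel]

end Embedding

/-! ### The implicit midpoint step. -/

section Midpoint

variable {V : Type*} [NormedAddCommGroup V] [NormedSpace ℝ V]

/-- A small, smooth, compactly supported perturbation of the identity is a diffeomorphism. -/
theorem exists_diffeomorph_id_add [FiniteDimensional ℝ V] {X : V → V} (hX : ContDiff ℝ ∞ X)
    (hb : ∀ x, ‖fderiv ℝ X x‖ ≤ 1 / 2) :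
    ∃ β : Diffeomorph 𝓘(ℝ, V) 𝓘(ℝ, V) V V ∞, ∀ x, β x = x + X x := by
  have hd : Differentiable ℝ X := hX.differentiable (by simp)
  have hLip : LipschitzWith (1 / 2) X :=
    lipschitzWith_of_nnnorm_fderiv_le hd fun x => by
      rw [← NNReal.coe_le_coe]
      simpa using hb x
  have happ : ApproximatesLinearOn (fun x => x + X x)
      ((ContinuousLinearEquiv.refl ℝ V : V ≃L[ℝ] V) : V →L[ℝ] V) univ (1 / 2) := by
    intro x _ y _
    have h : x + X x - (y + X y) -
        ((ContinuousLinearEquiv.refl ℝ V : V ≃L[ℝ] V) : V →L[ℝ] V) (x - y) = X x - X y := by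
      simp; abel
    rw [h]
    exact hLip.norm_sub_le x y
  have hc : Subsingleton V ∨ (1 / 2 : NNReal) <
      ‖((ContinuousLinearEquiv.refl ℝ V).symm : V →L[ℝ] V)‖₊⁻¹ := by
    rcases subsingleton_or_nontrivial V with h | h
    · exact Or.inl h
    · right
      have : ((ContinuousLinearEquiv.refl ℝ V).symm : V →L[ℝ] V) = ContinuousLinearMap.id ℝ V := rfl
      rw [this, ContinuousLinearMap.nnnorm_id, inv_one]
      exact NNReal.half_lt_self one_ne_zero
  let b : V ≃ₜ V := happ.toHomeomorph _ hc
  have hbx : ∀ x, b x = x + X x := fun x => rfl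
  have hunit : ∀ x, ‖-fderiv ℝ X x‖ < 1 := fun x => by
    rw [norm_neg]; linarith [hb x]
  -- The derivative `1 + DX` is invertible since `‖DX‖ < 1`; this makes the inverse homeomorphism
  -- smooth.
  let A : V → (V ≃L[ℝ] V) := fun x => ContinuousLinearEquiv.ofUnit (Units.oneSub _ (hunit x))
  have hA : ∀ x, HasFDerivAt b (A x : V →L[ℝ] V) x := by
    intro x
    have h1 : (A x : V →L[ℝ] V) = ContinuousLinearMap.id ℝ V + fderiv ℝ X x := by
      ext v
      change ((Units.oneSub _ (hunit x) : (V →L[ℝ] V)ˣ) : V →L[ℝ] V) v = _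
      simp
    rw [h1]
    exact (hasFDerivAt_id x).add (hd x).hasFDerivAt
  have hcd : ContDiff ℝ ∞ b := contDiff_id.add hX
  have hcs : ContDiff ℝ ∞ b.symm := b.contDiff_symm hA hcd
  exact ⟨⟨b.toEquiv, hcd.contMDiff, hcs.contMDiff⟩, hbx⟩

/-- The implicit midpoint step of a small Hamiltonian vector field preserves the symplectic form:
`id - X` and `id + X` pull it back to the same form. -/
theorem apply_add_eq_apply_sub {B : V →L[ℝ] V →L[ℝ] ℝ} (hB : ∀ u v, B u v = -B v u)
    {L : (V →L[ℝ] ℝ) →L[ℝ] V} (hL : ∀ α v, B (L α) v = α v) {h : V → ℝ} (hh : ContDiff ℝ ∞ h)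
    (x u v : V) :
    B (u + fderiv ℝ (fun z => L (fderiv ℝ h z)) x u) (v + fderiv ℝ (fun z => L (fderiv ℝ h z)) x v) =
    B (u - fderiv ℝ (fun z => L (fderiv ℝ h z)) x u)
      (v - fderiv ℝ (fun z => L (fderiv ℝ h z)) x v) := by
  have hd : DifferentiableAt ℝ (fderiv ℝ h) x :=
    ((hh.fderiv_right (m := ∞) (by simp)).differentiable (by simp)) x
  have hA : fderiv ℝ (fun z => L (fderiv ℝ h z)) x = L.comp (fderiv ℝ (fderiv ℝ h) x) :=
    (L.hasFDerivAt.comp x hd.hasFDerivAt).fderiv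
  have hsymm : fderiv ℝ (fderiv ℝ h) x u v = fderiv ℝ (fderiv ℝ h) x v u :=
    (hh.contDiffAt.isSymmSndFDerivAt (by
      rw [minSmoothness_of_isRCLikeNormedField]; exact ENat.LEInfty.out)) u v
  rw [hA]
  -- With `A` the derivative of the field, the sides differ by `2 (B (A u) v + B u (A v))`, which is
  -- twice `D²h u v - D²h v u = 0`.
  simp only [ContinuousLinearMap.comp_apply, map_add, map_sub, add_apply, sub_apply, hL]
  rw [hB u (L _), hL, hsymm]
  ring

end Midpoint

/-! ### Nondegeneracy of the standard form, and perturbations of the real line. -/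

section Standard

variable {n : ℕ}

/-- The standard symplectic form as a continuous bilinear map. -/
def stdBilin (n : ℕ) : Space n →L[ℝ] Space n →L[ℝ] ℝ :=
  ∑ i : Fin n,
    ((EuclideanSpace.proj (𝕜 := ℝ) (⟨2 * i, by omega⟩ : Fin (2 * n))).smulRight
        (EuclideanSpace.proj (𝕜 := ℝ) (⟨2 * i + 1, by omega⟩ : Fin (2 * n))) -
      (EuclideanSpace.proj (𝕜 := ℝ) (⟨2 * i + 1, by omega⟩ : Fin (2 * n))).smulRight
        (EuclideanSpace.proj (𝕜 := ℝ) (⟨2 * i, by omega⟩ : Fin (2 * n))))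

theorem stdBilin_apply (u v : Space n) :
    stdBilin n u v = ∑ i : Fin n, (xCoord i u * yCoord i v - yCoord i u * xCoord i v) := by
  simp [stdBilin, xCoord, yCoord]

theorem stdAlt_eq_stdBilin (v : Fin 2 → Space n) : stdAlt n v = stdBilin n (v 0) (v 1) := by
  rw [stdAlt_apply, stdBilin_apply]
  exact Finset.sum_congr rfl fun i _ => by ring

theorem stdBilin_antisymm (u v : Space n) : stdBilin n u v = -stdBilin n v u := by
  rw [stdBilin_apply, stdBilin_apply, ← Finset.sum_neg_distrib]
  exact Finset.sum_congr rfl fun i _ => by ring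

theorem xCoord_single (i : Fin n) (k : Fin (2 * n)) (s : ℝ) :
    xCoord i (EuclideanSpace.single k s) = if 2 * (i : ℕ) = k then s else 0 := by
  simp [xCoord, Fin.ext_iff]

theorem yCoord_single (i : Fin n) (k : Fin (2 * n)) (s : ℝ) :
    yCoord i (EuclideanSpace.single k s) = if 2 * (i : ℕ) + 1 = k then s else 0 := by
  simp [yCoord, Fin.ext_iff]

theorem stdBilin_single_x (i : Fin n) (s : ℝ) (v : Space n) :
    stdBilin n (EuclideanSpace.single ⟨2 * i, by omega⟩ s) v = s * yCoord i v := by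
  rw [stdBilin_apply, Finset.sum_eq_single i]
  · rw [xCoord_single, yCoord_single, if_pos rfl, if_neg (by simp)]
    ring
  · intro k _ hk
    have : (k : ℕ) ≠ i := fun h => hk (Fin.ext h)
    rw [xCoord_single, yCoord_single, if_neg (by simpa using this), if_neg (by simp; omega)]
    ring
  · simp

theorem stdBilin_single_y (i : Fin n) (s : ℝ) (v : Space n) :
    stdBilin n (EuclideanSpace.single ⟨2 * i + 1, by omega⟩ s) v = -(s * xCoord i v) := by
  rw [stdBilin_apply, Finset.sum_eq_single i]
  · rw [xCoord_single, yCoord_single, if_pos rfl, if_neg (by simp)]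
    ring
  · intro k _ hk
    have : (k : ℕ) ≠ i := fun h => hk (Fin.ext h)
    rw [xCoord_single, yCoord_single, if_neg (by simp; omega), if_neg (by simpa using this)]
    ring
  · simp

/-- Pairing with basis vectors shows nondegeneracy, and equality of dimensions gives the inverse.
`L` turns the differential of a Hamiltonian into its vector field. -/
theorem exists_sharp (n : ℕ) : ∃ L : (Space n →L[ℝ] ℝ) →L[ℝ] Space n,
    (∀ α v, stdBilin n (L α) v = α v) ∧ ∀ w, L (stdBilin n w) = w := by
  have hinj : Function.Injective (stdBilin n : Space n →ₗ[ℝ] (Space n →L[ℝ] ℝ)) := by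
    rw [injective_iff_map_eq_zero]
    intro w hw
    have h : ∀ v, stdBilin n v w = 0 := fun v => by
      rw [stdBilin_antisymm]
      have : stdBilin n w = 0 := hw
      simp [this]
    ext k
    rcases Nat.even_or_odd' (k : ℕ) with ⟨i, hi | hi⟩
    · have h1 := h (EuclideanSpace.single ⟨2 * i + 1, by omega⟩ 1)
      have h2 := stdBilin_single_y (⟨i, by omega⟩ : Fin n) 1 w
      rw [h1] at h2
      have h3 : xCoord (⟨i, by omega⟩ : Fin n) w = w k := congrArg w (Fin.ext hi.symm)
      rw [h3] at h2
      simp only [PiLp.zero_apply]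
      linarith
    · have h1 := h (EuclideanSpace.single ⟨2 * i, by omega⟩ 1)
      have h2 := stdBilin_single_x (⟨i, by omega⟩ : Fin n) 1 w
      rw [h1] at h2
      have h3 : yCoord (⟨i, by omega⟩ : Fin n) w = w k := congrArg w (Fin.ext hi.symm)
      rw [h3] at h2
      simp only [PiLp.zero_apply]
      linarith
  have hfin : Module.finrank ℝ (Space n) = Module.finrank ℝ (Space n →L[ℝ] ℝ) := by
    rw [← (LinearMap.toContinuousLinearMap (𝕜 := ℝ) (E := Space n) (F' := ℝ)).finrank_eq]
    exact Subspace.dual_finrank_eq.symm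
  let Λ := LinearEquiv.ofInjectiveOfFinrankEq _ hinj hfin
  refine ⟨LinearMap.toContinuousLinearMap (Λ.symm : (Space n →L[ℝ] ℝ) →ₗ[ℝ] Space n),
    fun α v => ?_, fun w => ?_⟩
  · exact congrArg (fun β : Space n →L[ℝ] ℝ => β v) (Λ.apply_symm_apply α)
  · exact Λ.symm_apply_apply w

end Standard

/-- A continuous injection of `ℝ` is strictly monotone, and bounded distance from the identity
excludes decrease and forces both limits at infinity. -/
theorem strictMono_surjective_of_bounded_perturbation {g : ℝ → ℝ} (hg : Continuous g)
    (hinj : Function.Injective g) {C : ℝ} (hC : ∀ s, |g s - s| ≤ C) :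
    StrictMono g ∧ Function.Surjective g := by
  have h1 : ∀ s, s - C ≤ g s := fun s => by linarith [(abs_le.1 (hC s)).1]
  have h2 : ∀ s, g s ≤ s + C := fun s => by linarith [(abs_le.1 (hC s)).2]
  constructor
  · rcases hg.strictMono_of_inj hinj with h | h
    · exact h
    · have h0 : 0 ≤ C := (abs_nonneg _).trans (hC 0)
      have := h (show (0 : ℝ) < 2 * C + 1 by linarith)
      linarith [h1 (2 * C + 1), h2 0]
  · refine hg.surjective ?_ ?_
    · exact Filter.tendsto_atTop_mono h1 (Filter.tendsto_atTop_add_const_right _ _ Filter.tendsto_id)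
    · exact Filter.tendsto_atBot_mono h2 (Filter.tendsto_atBot_add_const_right _ _ Filter.tendsto_id)

theorem image_Ici_of_strictMono_surjective {g : ℝ → ℝ} (h : StrictMono g)
    (h' : Function.Surjective g) (a : ℝ) : g '' Ici a = Ici (g a) :=
  (h.orderIsoOfSurjective g h').image_Ici a

/-! ### Pushing the standard ray into itself. -/

section Push

variable {n : ℕ} [NeZero n]

/-- The line that contains the standard ray. -/
def stdLine (n : ℕ) [NeZero n] (s : ℝ) : Space n :=
  EuclideanSpace.single ⟨2 * (lastIdx n : ℕ), by have := (lastIdx n).isLt; omega⟩ s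

theorem stdLine_eq_smul (s : ℝ) : stdLine n s = s • stdLine n 1 := by
  ext k
  simp [stdLine]

theorem stdLine_add (s t : ℝ) : stdLine n (s + t) = stdLine n s + stdLine n t := by
  rw [stdLine_eq_smul, stdLine_eq_smul s, stdLine_eq_smul t, add_smul]

theorem continuous_stdLine : Continuous (stdLine n) := by
  have : stdLine n = fun s => s • stdLine n 1 := funext stdLine_eq_smul
  rw [this]
  fun_prop

theorem stdLine_injective : Function.Injective (stdLine n) := fun s t h => by
  have := congrArg (xCoord (lastIdx n)) h
  simpa [stdLine, xCoord_single] using this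

/-- A diffeomorphism that moves the points of the standard line along it by bounded amounts maps the
ray at `a` onto another ray. -/
theorem image_stdLine_of_perturbation {β : Space n → Space n} (hβc : Continuous β)
    (hβ : Function.Injective β) {f : ℝ → ℝ} {C : ℝ} (hC : ∀ s, |f s| ≤ C)
    (hf : ∀ s, β (stdLine n s) = stdLine n (s + f s)) :
    Function.Surjective (fun s => s + f s) ∧
      ∀ a, β '' (stdLine n '' Ici a) = stdLine n '' Ici (a + f a) := by
  have hcoord : ∀ s, s + f s = xCoord (lastIdx n) (β (stdLine n s)) := fun s => by
    rw [hf, stdLine, xCoord_single, if_pos rfl]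
  have hcont : Continuous fun s => s + f s := by
    simp only [hcoord]
    have h : Continuous fun z : Space n => xCoord (lastIdx n) z := by
      unfold xCoord
      fun_prop
    exact h.comp (hβc.comp continuous_stdLine)
  have hinj : Function.Injective fun s => s + f s := fun s t hst => by
    apply stdLine_injective (n := n)
    apply hβ
    rw [hf, hf]
    exact congrArg _ hst
  obtain ⟨hm, hs⟩ := strictMono_surjective_of_bounded_perturbation hcont hinj (C := C)
    (fun s => by simpa using hC s)
  refine ⟨hs, fun a => ?_⟩
  rw [← image_Ici_of_strictMono_surjective hm hs a, image_image, image_image]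
  exact image_congr fun s _ => hf s

/-- The midpoint step for the Hamiltonian `χ * y`. The step length `η` is independent of the tip
`a`, so that iteration makes definite progress until the tip passes `t + 1`. -/
theorem exists_small_push {K : Set (Space n)} (hK : IsCompact K) {t : ℝ} {χ : Space n → ℝ}
    (hχ : ContDiff ℝ ∞ χ) (hχ01 : ∀ z, χ z ∈ Icc (0 : ℝ) 1) (hχK : ∀ z ∉ K, χ z = 0)
    (hχ1 : ∀ s ∈ Icc t (t + 1), χ (stdLine n s) = 1) :
    ∃ η > 0, ∃ ψ : Diffeomorph (𝓡 (2 * n)) (𝓡 (2 * n)) (Space n) (Space n) ∞,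
      TwoForm.pullback (𝓡 (2 * n)) (𝓡 (2 * n)) ψ (stdForm n) = stdForm n ∧
      (∀ x ∉ K, ψ x = x) ∧
      ∀ a ≥ t, ∃ a' ≥ a, (a' ≤ t + 1 → a' = a + η) ∧
        ψ '' (stdLine n '' Ici a) = stdLine n '' Ici a' := by
  obtain ⟨L, hL, hL'⟩ := exists_sharp n
  let y : Space n →L[ℝ] ℝ := stdBilin n (stdLine n 1)
  have hy : ∀ s, y (stdLine n s) = 0 := fun s => by
    change stdBilin n _ _ = 0
    rw [stdLine, stdBilin_single_x, stdLine, yCoord_single, if_neg (by simp)]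
    ring
  have hamil : ∀ τ : ℝ, ContDiff ℝ ∞ fun z => τ * (χ z * y z) := fun τ =>
    contDiff_const.mul (hχ.mul y.contDiff)
  let X : ℝ → Space n → Space n := fun τ z => L (fderiv ℝ (fun z => τ * (χ z * y z)) z)
  have hX : ∀ τ, ContDiff ℝ ∞ (X τ) := fun τ =>
    L.contDiff.comp ((hamil τ).fderiv_right (m := ∞) (by simp))
  have hXτ : ∀ τ z, X τ z = τ • X 1 z := fun τ z => by
    have hd : DifferentiableAt ℝ (fun z => 1 * (χ z * y z)) z :=
      ((hamil 1).differentiable (by simp)) z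
    have : (fun z => τ * (χ z * y z)) = fun z => τ • (1 * (χ z * y z)) := by
      funext z; simp
    simp only [X]
    rw [this, fderiv_fun_const_smul hd, map_smul]
  have hXK : ∀ τ, ∀ z ∉ K, X τ z = 0 := fun τ z hz => by
    have : (fun z => τ * (χ z * y z)) =ᶠ[𝓝 z] fun _ => 0 :=
      Filter.mem_of_superset (hK.isClosed.isOpen_compl.mem_nhds hz) fun w hw => by
        simp [hχK w hw]
    simp only [X]
    rw [this.fderiv_eq]
    simp
  -- Since `y` vanishes on the line, the term with the derivative of `χ` drops out, and the field is
  -- tangent to the line.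
  have hXline : ∀ τ s, X τ (stdLine n s) = stdLine n (τ * χ (stdLine n s)) := fun τ s => by
    have h1 : HasFDerivAt (fun z => χ z * y z)
        (χ (stdLine n s) • y + y (stdLine n s) • fderiv ℝ χ (stdLine n s)) (stdLine n s) :=
      ((hχ.differentiable (by simp)) _).hasFDerivAt.mul y.hasFDerivAt
    have h2 := (h1.const_mul τ).fderiv
    simp only [X]
    rw [h2, hy, zero_smul, add_zero, map_smul, map_smul, hL', smul_smul, ← stdLine_eq_smul]
  obtain ⟨C, hC⟩ : ∃ C, ∀ z, ‖fderiv ℝ (X 1) z‖ ≤ C := by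
    have hc : HasCompactSupport (X 1) := HasCompactSupport.intro hK (hXK 1)
    exact ((hX 1).continuous_fderiv (by simp)).bounded_above_of_compact_support
      (hc.fderiv (𝕜 := ℝ))
  have hC0 : 0 ≤ C := (norm_nonneg _).trans (hC 0)
  -- Chosen so that `τ * (C + 1) = 1 / 2`; this bounds the derivative of `X (±τ)` by `1 / 2`.
  let τ : ℝ := 1 / (2 * (C + 1))
  have hτ : 0 < τ := by positivity
  have hsmall : ∀ σ : ℝ, |σ| = τ → ∀ z, ‖fderiv ℝ (X σ) z‖ ≤ 1 / 2 := fun σ hσ z => by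
    have h1 : X σ = fun z => σ • X 1 z := funext (hXτ σ)
    rw [h1, fderiv_fun_const_smul ((hX 1).differentiable (by simp) z), norm_smul, Real.norm_eq_abs,
      hσ]
    have h2 : τ * (C + 1) = 1 / 2 := by simp only [τ]; field_simp
    nlinarith [hC z, norm_nonneg (fderiv ℝ (X 1) z)]
  obtain ⟨βp, hβp⟩ := exists_diffeomorph_id_add (hX τ) (hsmall τ (abs_of_pos hτ))
  obtain ⟨βm, hβm⟩ := exists_diffeomorph_id_add (hX (-τ)) (hsmall (-τ) (by
    rw [abs_neg, abs_of_pos hτ]))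
  have hXneg : ∀ z, X (-τ) z = -X τ z := fun z => by rw [hXτ, hXτ τ, neg_smul]
  have hform : TwoForm.pullback (𝓡 (2 * n)) (𝓡 (2 * n)) βp (stdForm n) =
      TwoForm.pullback (𝓡 (2 * n)) (𝓡 (2 * n)) βm (stdForm n) := by
    funext z
    have hd : HasFDerivAt (X τ) (fderiv ℝ (X τ) z) z :=
      ((hX τ).differentiable (by simp) z).hasFDerivAt
    have hp : (mfderiv (𝓡 (2 * n)) (𝓡 (2 * n)) βp z : Space n →L[ℝ] Space n) =
        ContinuousLinearMap.id ℝ _ + fderiv ℝ (X τ) z := by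
      rw [mfderiv_eq_fderiv]
      have : (βp : Space n → Space n) = fun z => z + X τ z := funext hβp
      rw [this]
      exact ((hasFDerivAt_id z).add hd).fderiv
    have hm : (mfderiv (𝓡 (2 * n)) (𝓡 (2 * n)) βm z : Space n →L[ℝ] Space n) =
        ContinuousLinearMap.id ℝ _ - fderiv ℝ (X τ) z := by
      rw [mfderiv_eq_fderiv]
      have : (βm : Space n → Space n) = fun z => z - X τ z := funext fun z => by
        rw [hβm, hXneg, sub_eq_add_neg]
      rw [this]
      exact ((hasFDerivAt_id z).sub hd).fderiv
    refine TwoForm.pullback_ext fun v => ?_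
    rw [hp, hm]
    refine (stdAlt_eq_stdBilin _).trans (Eq.trans ?_ (stdAlt_eq_stdBilin _).symm)
    exact apply_add_eq_apply_sub stdBilin_antisymm hL (hamil τ) z (v 0) (v 1)
  let ψ : Diffeomorph (𝓡 (2 * n)) (𝓡 (2 * n)) (Space n) (Space n) ∞ := βm.symm.trans βp
  have hψ : ∀ x, ψ (βm x) = βp x := fun x => congrArg βp (βm.symm_apply_apply x)
  have hχτ : ∀ s, |τ * χ (stdLine n s)| ≤ τ := fun s => by
    have := hχ01 (stdLine n s)
    rw [abs_of_nonneg (mul_nonneg hτ.le this.1)]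
    nlinarith [this.2]
  obtain ⟨-, hip⟩ := image_stdLine_of_perturbation (n := n) βp.continuous βp.injective hχτ
    (fun s => by rw [hβp, hXline, stdLine_add])
  obtain ⟨hsm, him⟩ := image_stdLine_of_perturbation (n := n) βm.continuous βm.injective
    (f := fun s => -τ * χ (stdLine n s)) (C := τ)
    (fun s => by rw [neg_mul, abs_neg]; exact hχτ s)
    (fun s => by rw [hβm, hXline, stdLine_add])
  refine ⟨2 * τ, by positivity, ψ, TwoForm.pullback_trans _ _ (TwoForm.pullback_symm βm rfl) hform,
    fun x hx => ?_, fun a ha => ?_⟩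
  · have h1 : βm x = x := by rw [hβm, hXK _ x hx, add_zero]
    have h2 := hψ x
    rw [h1] at h2
    rw [h2, hβp, hXK _ x hx, add_zero]
  -- Here `b` is the midpoint of the step: `a = b - τ χ(b)` and `a' = b + τ χ(b)`. If `a' ≤ t + 1`,
  -- then `b` lies in `[t, t + 1]`, where `χ = 1`, so the step has length `2 τ`.
  · obtain ⟨b, hb⟩ := hsm a
    simp only at hb
    have hb0 := mul_nonneg hτ.le (hχ01 (stdLine n b)).1
    refine ⟨b + τ * χ (stdLine n b), ?_, fun hle => ?_, ?_⟩
    · linarith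
    · have : χ (stdLine n b) = 1 := hχ1 b ⟨by linarith, by linarith⟩
      rw [this] at hb ⊢
      linarith
    · rw [← hip b, ← hb, ← him b, image_image ψ]
      exact image_congr fun x _ => hψ x

theorem exists_push {D : Set (Space n)} (hD : IsOpen D) {t : ℝ} (hDt : stdLine n '' Ici t ⊆ D) :
    ∃ t' ≥ t + 1, ∃ K ⊆ D, IsCompact K ∧
      ∃ ψ : Diffeomorph (𝓡 (2 * n)) (𝓡 (2 * n)) (Space n) (Space n) ∞,
      TwoForm.pullback (𝓡 (2 * n)) (𝓡 (2 * n)) ψ (stdForm n) = stdForm n ∧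
      (∀ x ∉ K, ψ x = x) ∧ ψ '' (stdLine n '' Ici t) = stdLine n '' Ici t' := by
  have hseg : IsCompact (stdLine n '' Icc t (t + 1)) := isCompact_Icc.image continuous_stdLine
  obtain ⟨K, hK, hsK, hKD⟩ := exists_compact_between hseg hD
    ((image_mono Icc_subset_Ici_self).trans hDt)
  obtain ⟨χ, hχ1, hχ0, hχ01⟩ := exists_contMDiffMap_one_nhds_of_subset_interior (n := ⊤)
    𝓘(ℝ, Space n) hseg.isClosed hsK
  obtain ⟨η, hη, ψ, hψ, hψK, hpush⟩ := exists_small_push hK (t := t) χ.contMDiff.contDiff hχ01 hχ0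
    fun s hs => hχ1.self_of_nhdsSet _ (mem_image_of_mem _ hs)
  -- Every step gains `η` until the tip passes `t + 1`; afterwards it only needs not to move back.
  have hiter : ∀ N : ℕ, ∃ a ≥ t, min (t + 1) (t + N * η) ≤ a ∧
      ∃ ψ : Diffeomorph (𝓡 (2 * n)) (𝓡 (2 * n)) (Space n) (Space n) ∞,
      TwoForm.pullback (𝓡 (2 * n)) (𝓡 (2 * n)) ψ (stdForm n) = stdForm n ∧
      (∀ x ∉ K, ψ x = x) ∧ ψ '' (stdLine n '' Ici t) = stdLine n '' Ici a := by
    intro N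
    induction N with
    | zero =>
      exact ⟨t, le_rfl, by simp, Diffeomorph.refl _ _ _,
        funext fun x => TwoForm.pullback_id_apply _ x, fun _ _ => rfl, by simp⟩
    | succ N ih =>
      obtain ⟨a, hat, hmin, φ, hφ, hφK, hφa⟩ := ih
      obtain ⟨a', ha', hstep, himg⟩ := hpush a hat
      refine ⟨a', hat.trans ha', ?_, φ.trans ψ, TwoForm.pullback_trans _ _ hφ hψ,
        fun x hx => ?_, ?_⟩
      · rcases le_total a' (t + 1) with h | h
        · have h1 := hstep h
          rcases min_le_iff.1 hmin with h2 | h2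
          · linarith
          · refine (min_le_right _ _).trans ?_
            push_cast
            linarith
        · exact (min_le_left _ _).trans h
      · rw [Diffeomorph.coe_trans, Function.comp_apply, hφK x hx, hψK x hx]
      · rw [Diffeomorph.coe_trans, image_comp, hφa, himg]
  obtain ⟨N, hN⟩ := exists_nat_ge (1 / η)
  obtain ⟨a, -, hmin, φ, hφ⟩ := hiter N
  refine ⟨a, ?_, K, hKD, hK, φ, hφ⟩
  have : 1 ≤ N * η := (div_le_iff₀ hη).1 hN
  rwa [min_eq_left (by linarith)] at hmin

end Push

/-! ### Removal of the ray from the manifold. -/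

section Main

variable {n : ℕ} [NeZero n] {M : Type*} [TopologicalSpace M] [ChartedSpace (Space n) M]

theorem exists_extendsRay {Ω : TwoForm (𝓡 (2 * n)) M} {γ : EuclideanHalfSpace 1 → M}
    (h : IsRayWide Ω γ ∨ ∃ ε : ℝ, 0 < ε ∧ ExtendsRay Ω γ (ballProd n ε (planarW ε))) :
    ∃ D, ExtendsRay Ω γ D := by
  rcases h with h | ⟨ε, -, h⟩
  · unfold IsRayWide rayWidth at h
    simp only [lt_iSup_iff] at h
    obtain ⟨ε, ⟨-, h⟩, -⟩ := h
    exact ⟨_, h⟩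
  · exact ⟨_, h⟩

theorem symplectomorphic_of_extendsRay [T2Space M] [SecondCountableTopology M]
    {Ω : TwoForm (𝓡 (2 * n)) M} {γ : EuclideanHalfSpace 1 → M} (hγ : IsProperRay n γ)
    {D : TopologicalSpace.Opens (Space n)} (h : ExtendsRay Ω γ D) :
    Symplectomorphic (𝓡 (2 * n)) (𝓡 (2 * n)) Ω
      (TwoForm.restrict (𝓡 (2 * n)) Ω (rayCompl n γ hγ)) := by
  obtain ⟨hD, j, hj, hjγ⟩ := h
  let pt : ∀ s : ℝ, 0 ≤ s → EuclideanHalfSpace 1 := fun s hs =>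
    ⟨EuclideanSpace.single 0 s, by simpa using hs⟩
  have hpt : ∀ s hs, (pt s hs).1 0 = s := fun s hs => by simp [pt]
  have : Nonempty D := ⟨⟨_, hD (pt 0 le_rfl)⟩⟩
  obtain ⟨e, hsource, hej, he, he', hΩ⟩ := exists_openPartialHomeomorph D hj
  have hray : ∀ s, e (stdLine n (s.1 0)) = γ s := fun s => by
    rw [← hjγ s, ← hej]
    rfl
  have hline : ∀ s ≥ 0, stdLine n s ∈ e.source := fun s hs => by
    rw [hsource]
    have := hD (pt s hs)
    unfold stdRay at this
    rwa [hpt s hs] at this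
  let c : ℝ → M := fun s => e (stdLine n s)
  have hc : ∀ s, ∀ hs : 0 ≤ s, c s = γ (pt s hs) := fun s hs => by
    rw [← hray, hpt s hs]
  have hcimg : ∀ t, c '' Ici t = e '' (stdLine n '' Ici t) := fun t => (image_image _ _ _).symm
  have hrange : c '' Ici 0 = range γ := by
    ext p
    constructor
    · rintro ⟨s, hs, rfl⟩
      exact ⟨_, (hc s hs).symm⟩
    · rintro ⟨s, rfl⟩
      exact ⟨s.1 0, s.2, hray s⟩
  have : LocallyCompactSpace M := ChartedSpace.locallyCompactSpace (Space n) M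
  refine symplectomorphic_of_exists_push (c := c) (rayCompl n γ hγ)
    (by rw [hrange]; rfl) (fun K hK => ?_) fun t ht N hN htN => ?_
  · have h1 : IsCompact (γ ⁻¹' K) := hγ.isProperMap.isCompact_preimage hK
    have h2 : Continuous fun s : EuclideanHalfSpace 1 => s.1 0 := by
      have : Continuous fun z : EuclideanSpace ℝ (Fin 1) => z 0 := by fun_prop
      exact this.comp continuous_subtype_val
    obtain ⟨T, hT⟩ := (h1.image h2).bddAbove
    refine ⟨max 0 (T + 1), fun s hs hsK => ?_⟩
    have hs0 : 0 ≤ s := (le_max_left _ _).trans hs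
    have h3 : s ≤ T := hT ⟨pt s hs0, by rwa [mem_preimage, ← hc s hs0], hpt s hs0⟩
    linarith [(le_max_right 0 (T + 1)).trans hs]
  -- The push is made inside the preimage of `N`, so its extension to `M` is supported in `N`.
  · have hopen : IsOpen (e.source ∩ e ⁻¹' N) := e.isOpen_inter_preimage hN
    obtain ⟨t', ht', K, hKD, hK, ψ, hψ, hψK, himg⟩ := exists_push hopen (t := t) (by
      rintro _ ⟨s, hs, rfl⟩
      exact ⟨hline s (ht.le.trans hs), htN ⟨s, hs, rfl⟩⟩)
    have hKe : K ⊆ e.source := fun x hx => (hKD hx).1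
    obtain ⟨φ, hφ, hφK, hφe⟩ := exists_diffeomorph_extend e he he' hΩ ψ hψ hK hKe hψK
    refine ⟨t', ht', φ, hφ, fun p hp => hφK p ?_, ?_⟩
    · rintro ⟨x, hx, rfl⟩
      exact hp (hKD hx).2
    · rw [hcimg, hcimg, ← himg, image_image, image_image e]
      refine image_congr fun x hx => ?_
      obtain ⟨s, hs, rfl⟩ := hx
      exact hφe _ (hline s (ht.le.trans hs))

end Main

end RayRemoval

end

end RayRemovalProofs

theorem corollary1p2 {n : ℕ} [NeZero n]
    {M : Type*} [TopologicalSpace M] [T2Space M] [SecondCountableTopology M] [NoncompactSpace M]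
    [ChartedSpace (RayRemoval.Space n) M] [IsManifold (𝓡 (2 * n)) ∞ M]
    (Ω : RayRemoval.TwoForm (𝓡 (2 * n)) M)
    (hΩ : RayRemoval.IsSymplecticForm (𝓡 (2 * n)) Ω)
    (γ : EuclideanHalfSpace 1 → M) (hγ : RayRemoval.IsProperRay n γ)
    (hwide : RayRemoval.IsRayWide Ω γ ∨
      ∃ ε : ℝ, 0 < ε ∧
        RayRemoval.ExtendsRay Ω γ (RayRemoval.ballProd n ε (RayRemoval.planarW ε))) :
    RayRemoval.Symplectomorphic (𝓡 (2 * n)) (𝓡 (2 * n)) Ω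
      (RayRemoval.TwoForm.restrict (𝓡 (2 * n)) Ω (RayRemoval.rayCompl n γ hγ)) := by
  obtain ⟨D, hD⟩ := RayRemoval.exists_extendsRay hwide
  exact RayRemoval.symplectomorphic_of_extendsRay hγ hD
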